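/- Let $k$ be a field of characteristic zero, let $R=k[x_0,x_1,x_2,x_3]$, and let $F=L_1\cdots L_d\in R$ be a product of pairwise linearly independent nonzero linear forms, so that $F$ defines an arrangement of $d$ distinct planes in $\mathbb P^3$. Let $J=\langle \partial F/\partial x_0,\dots,\partial F/\partial x_3\rangle$ be the Jacobian ideal of $F$, and let $\sqrt J=\bigcap_i\mathfrak p_i$, where the $\mathfrak p_i$ are the distinct minimal primes of $J$. For each $i$ let $a_i$ be the number of indices $j$ with $L_j\in\mathfrak p_i$. Choose integers $b_i$ such that $b_i=1$ if $a_i=2$, and $0\le b_i\le a_i$ otherwise (with the convention $\mathfrak p_i^0=R$). Assume that no factor $L_j$ of $F$ lies in two distinct $\mathfrak p_i$ with $a_i\ge 3$. Then the ring $R/\bigcap_i\mathfrak p_i^{b_i}$ is Cohen–Macaulay (the zero ring being regarded as Cohen–Macaulay). -/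

import Mathlib

/-- A local ring `A` is Cohen–Macaulay if it is Noetherian and its depth equals its Krull dimension,
i.e. some `A`-regular sequence has length `dim A`. (`RingTheory.Sequence.IsRegular` includes
`(r₁, …, rₙ) ≠ A`, so the terms of the sequence lie in the maximal ideal; and no regular sequence is
longer than `dim A`.) -/
structure IsCohenMacaulayLocalRing (A : Type*) [CommRing A] [IsLocalRing A] : Prop where
  isNoetherianRing : IsNoetherianRing A
  exists_isRegular : ∃ rs : List A,
    RingTheory.Sequence.IsRegular A rs ∧ ((rs.length : ℕ∞) : WithBot ℕ∞) = ringKrullDim A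

/-- A commutative ring is Cohen–Macaulay if it is Noetherian and all its localizations at maximal
ideals are Cohen–Macaulay local rings. (As usual, the zero ring is Cohen–Macaulay.) -/
structure IsCohenMacaulayRing (A : Type*) [CommRing A] : Prop where
  isNoetherianRing : IsNoetherianRing A
  localization_atMaximal : ∀ (m : Ideal A) [m.IsMaximal],
    IsCohenMacaulayLocalRing (Localization.AtPrime m)

namespace PlaneArrangement

/-- The homogeneous coordinate ring `k[x₀, x₁, x₂, x₃]` of `ℙ³`. -/
abbrev CoordRing (k : Type*) [Field k] : Type _ := MvPolynomial (Fin 4) k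

variable {k : Type*} [Field k] {d : ℕ}

/-- The forms `L 0, …, L (d - 1)` define an arrangement of `d` distinct planes in `ℙ³`: they are
nonzero linear forms, pairwise linearly independent. -/
structure IsArrangement (L : Fin d → CoordRing k) : Prop where
  isHomogeneous : ∀ i, (L i).IsHomogeneous 1
  ne_zero : ∀ i, L i ≠ 0
  linearIndependent : ∀ i j, i ≠ j → LinearIndependent k ![L i, L j]

/-- The Jacobian ideal of `F`, generated by its partial derivatives. -/
noncomputable def jacobianIdeal (F : CoordRing k) : Ideal (CoordRing k) :=
  Ideal.span (Set.range fun j : Fin 4 => MvPolynomial.pderiv j F)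

/-- The Jacobian ideal `J` of the arrangement, that is, of the product `F = ∏ i, L i`. -/
noncomputable def arrangementIdeal (L : Fin d → CoordRing k) : Ideal (CoordRing k) :=
  jacobianIdeal (∏ i, L i)

/-- The number of factors of `F = ∏ i, L i` that lie in the ideal `p`. -/
noncomputable def numFactors (L : Fin d → CoordRing k) (p : Ideal (CoordRing k)) : ℕ :=
  {i : Fin d | L i ∈ p}.ncard

/-- The ideal `⋂ pᵢ ^ bᵢ`, where `pᵢ` runs over the minimal primes of `J`, i.e. over the components
in the irredundant prime decomposition `√J = ⋂ pᵢ`; here `p ^ 0` is the unit ideal. -/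
noncomputable def fatIdeal (L : Fin d → CoordRing k) (b : Ideal (CoordRing k) → ℕ) :
    Ideal (CoordRing k) :=
  ⨅ p ∈ (arrangementIdeal L).minimalPrimes, p ^ b p

end PlaneArrangement

/-! The minimal primes of `J` are the line ideals `(L i, L j)` with `i ≠ j`: Euler's formula puts
`F` in every prime over `J`, and the Leibniz rule then gives a second factor. Call a line multiple
if at least three planes contain it. By hypothesis a plane contains at most one multiple line, so
planes can be coloured by it, each remaining plane having its own colour. Lines joining planes of
different colours are simple and have exponent 1, so the ideal is the intersection of the powers `p
^ b p` of the multiple lines with the ideals `(L i, L j)` over pairs of different colours.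

This intersection is built colour by colour by liaison addition. If `G ∈ A`, `F ∈ B`, `F` is regular
modulo `A` and `G` modulo `B`, then `a * F + b * G ∈ A ⊓ B` exactly when `a ∈ A` and `b ∈ B`. A pair
weakly regular modulo `A`, `B` and `(F, G)` is therefore weakly regular modulo `A ⊓ B ⊓ (F, G)`.
Here `G` is the product of the old factors, `F` that of the new colour, and `b p ≤ numFactors L p`
gives `F ∈ p ^ b p`.

The pair consists of polynomials `f(y)`, `g(y')` in two generic linear forms, chosen inside a given
maximal ideal. For each line, `R ⧸ p ^ n` is free over `k[y, y']`, so the pair is regular there;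
modulo the pair only maximal primes survive, so depth and dimension are both 2. -/

namespace PlaneArrangement

/-! ### Weakly regular pairs and liaison addition -/

section RegularPair

variable {R : Type*} [CommRing R]

/-- `r` is a nonzerodivisor modulo the ideal `I`. -/
def IsRegularMod (I : Ideal R) (r : R) : Prop := ∀ x, r * x ∈ I → x ∈ I

/-- `f, g` is a weakly regular sequence on `R ⧸ I`. -/
structure IsRegularPairMod (f g : R) (I : Ideal R) : Prop where
  left : IsRegularMod I f
  right : ∀ x y, g * x - f * y ∈ I → ∃ z, x - f * z ∈ I

theorem IsRegularMod.inf {I J : Ideal R} {r : R} (hI : IsRegularMod I r) (hJ : IsRegularMod J r) :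
    IsRegularMod (I ⊓ J) r :=
  fun x hx => ⟨hI x hx.1, hJ x hx.2⟩

theorem IsRegularMod.iInf {ι : Sort*} {I : ι → Ideal R} {r : R} (h : ∀ i, IsRegularMod (I i) r) :
    IsRegularMod (⨅ i, I i) r := by
  intro x hx
  rw [Ideal.mem_iInf] at hx ⊢
  exact fun i => h i x (hx i)

theorem IsRegularMod.prod {κ : Type*} {I : Ideal R} {s : Finset κ} {L : κ → R}
    (h : ∀ i ∈ s, IsRegularMod I (L i)) : IsRegularMod I (∏ i ∈ s, L i) := by
  classical
  induction s using Finset.induction_on with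
  | empty => intro x hx; simpa using hx
  | insert a s ha ih =>
    intro x hx
    rw [Finset.prod_insert ha, mul_assoc] at hx
    exact ih (fun i hi => h i (Finset.mem_insert_of_mem hi)) x
      (h a (Finset.mem_insert_self a s) _ hx)

theorem isRegularMod_top (r : R) : IsRegularMod (⊤ : Ideal R) r := fun _ _ => trivial

theorem isRegularPairMod_top (f g : R) : IsRegularPairMod f g (⊤ : Ideal R) :=
  ⟨isRegularMod_top f, fun _ _ _ => ⟨0, trivial⟩⟩

/-- Modulo `A` the term `b * G` vanishes and `F` can be cancelled; modulo `B` the roles are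
exchanged. Hence `A ⊓ B ⊓ (F, G) = F * A + G * B`, with the two coefficients controlled
independently. -/
theorem linearCombination_mem_inf_iff {A B : Ideal R} {F G : R} (hGA : G ∈ A) (hFB : F ∈ B)
    (hF : IsRegularMod A F) (hG : IsRegularMod B G) {a b : R} :
    a * F + b * G ∈ A ⊓ B ↔ a ∈ A ∧ b ∈ B := by
  constructor
  · rintro ⟨h₁, h₂⟩
    refine ⟨hF a ?_, hG b ?_⟩
    · rw [mul_comm]
      exact (Ideal.add_mem_iff_left A (A.mul_mem_left b hGA)).1 h₁
    · rw [mul_comm]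
      exact (Ideal.add_mem_iff_right B (B.mul_mem_left a hFB)).1 h₂
  · rintro ⟨h₁, h₂⟩
    exact ⟨A.add_mem (A.mul_mem_right F h₁) (A.mul_mem_left b hGA),
      B.add_mem (B.mul_mem_left a hFB) (B.mul_mem_right G h₂)⟩

/-- Liaison addition. -/
theorem IsRegularPairMod.liaison {A B : Ideal R} {F G f g : R} (hGA : G ∈ A) (hFB : F ∈ B)
    (hF : IsRegularMod A F) (hG : IsRegularMod B G) (hA : IsRegularPairMod f g A)
    (hB : IsRegularPairMod f g B) (hFG : IsRegularPairMod f g (Ideal.span {F, G})) :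
    IsRegularPairMod f g (A ⊓ B ⊓ Ideal.span {F, G}) := by
  have key {a b : R} := linearCombination_mem_inf_iff (a := a) (b := b) hGA hFB hF hG
  constructor
  · intro x hx
    obtain ⟨hx, hx'⟩ := Ideal.mem_inf.1 hx
    have hxFG := hFG.left x hx'
    obtain ⟨a, b, rfl⟩ := Ideal.mem_span_pair.1 hxFG
    rw [show f * (a * F + b * G) = (f * a) * F + (f * b) * G by ring, key] at hx
    exact ⟨key.2 ⟨hA.left a hx.1, hB.left b hx.2⟩, hxFG⟩
  · intro x y hxy
    obtain ⟨hx, hx'⟩ := Ideal.mem_inf.1 hxy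
    -- Subtracting the trivial syzygy `(f * z, g * z)` moves `x` and `y` into `(F, G)` without
    -- changing `g * x - f * y`. The relation between their coefficients then splits into one modulo
    -- `A` and one modulo `B`.
    obtain ⟨z, hz⟩ := hFG.right x y hx'
    obtain ⟨a, b, hab⟩ := Ideal.mem_span_pair.1 hz
    have hy : y - g * z ∈ Ideal.span {F, G} := by
      apply hFG.left
      rw [show f * (y - g * z) = g * (x - f * z) - (g * x - f * y) by ring]
      exact Ideal.sub_mem _ (Ideal.mul_mem_left _ _ hz) hx'
    obtain ⟨a', b', hab'⟩ := Ideal.mem_span_pair.1 hy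
    rw [show g * x - f * y = (g * a - f * a') * F + (g * b - f * b') * G by
      linear_combination (-g) * hab + f * hab', key] at hx
    obtain ⟨a'', ha''⟩ := hA.right _ _ hx.1
    obtain ⟨b'', hb''⟩ := hB.right _ _ hx.2
    refine ⟨z + a'' * F + b'' * G, ?_⟩
    rw [show x - f * (z + a'' * F + b'' * G) = (a - f * a'') * F + (b - f * b'') * G by
      linear_combination -hab]
    exact ⟨key.2 ⟨ha'', hb''⟩, Ideal.mem_span_pair.2 ⟨_, _, rfl⟩⟩

/-- If `a * E + b * G` lies in `(E', G)`, so does `a * E`, and `E` can be cancelled. -/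
theorem span_mul_pair_eq_inf {E E' G : R} (hE : IsRegularMod (Ideal.span {E', G}) E) :
    Ideal.span {E * E', G} = Ideal.span {E', G} ⊓ Ideal.span {E, G} := by
  apply le_antisymm
  · rw [Ideal.span_le, Set.insert_subset_iff, Set.singleton_subset_iff]
    refine ⟨⟨?_, ?_⟩, ?_, ?_⟩
    · exact Ideal.mul_mem_left _ _ (Ideal.subset_span (by simp))
    · exact Ideal.mul_mem_right _ _ (Ideal.subset_span (by simp))
    · exact Ideal.subset_span (by simp)
    · exact Ideal.subset_span (by simp)
  · rintro x ⟨hx, hx'⟩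
    obtain ⟨a, b, rfl⟩ := Ideal.mem_span_pair.1 hx'
    have ha : a ∈ Ideal.span {E', G} := by
      apply hE
      rw [mul_comm]
      exact (Ideal.add_mem_iff_left _
        (Ideal.mul_mem_left _ b (Ideal.subset_span (by simp)))).1 hx
    obtain ⟨u, v, rfl⟩ := Ideal.mem_span_pair.1 ha
    exact Ideal.mem_span_pair.2 ⟨u, v * E + b, by ring⟩

variable {κ : Type*} {L : κ → R}

theorem span_prod_pair_eq_iInf {s : Finset κ} {G : R}
    (h : ∀ i ∈ s, ∀ j ∈ s, i ≠ j → IsRegularMod (Ideal.span {L j, G}) (L i)) :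
    Ideal.span {∏ i ∈ s, L i, G} = ⨅ i ∈ s, Ideal.span {L i, G} := by
  classical
  induction s using Finset.induction_on with
  | empty =>
    rw [Ideal.eq_top_iff_one _ |>.2 (Ideal.subset_span (by simp))]
    simp
  | insert a s ha ih =>
    have ih' := ih fun i hi j hj =>
      h i (Finset.mem_insert_of_mem hi) j (Finset.mem_insert_of_mem hj)
    rw [Finset.prod_insert ha, span_mul_pair_eq_inf, ih', Finset.iInf_insert, inf_comm]
    rw [ih']
    refine IsRegularMod.iInf fun i => IsRegularMod.iInf fun hi => ?_
    exact h a (Finset.mem_insert_self a s) i (Finset.mem_insert_of_mem hi)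
      (by rintro rfl; exact ha hi)

/-- Each factor is split off by liaison addition with `B = ⊤`, where the conditions on `B` are
empty. -/
theorem IsRegularPairMod.span_prod_pair {s : Finset κ} {G f g : R}
    (h : ∀ i ∈ s, ∀ j ∈ s, i ≠ j → IsRegularMod (Ideal.span {L j, G}) (L i))
    (hreg : ∀ i ∈ s, IsRegularPairMod f g (Ideal.span {L i, G})) :
    IsRegularPairMod f g (Ideal.span {∏ i ∈ s, L i, G}) := by
  classical
  induction s using Finset.induction_on with
  | empty =>
    rw [Ideal.eq_top_iff_one _ |>.2 (Ideal.subset_span (by simp))]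
    exact isRegularPairMod_top f g
  | insert a s ha ih =>
    have h' : ∀ i ∈ s, ∀ j ∈ s, i ≠ j → IsRegularMod (Ideal.span {L j, G}) (L i) := fun i hi j hj =>
      h i (Finset.mem_insert_of_mem hi) j (Finset.mem_insert_of_mem hj)
    have ih' := ih h' fun i hi => hreg i (Finset.mem_insert_of_mem hi)
    have hE : IsRegularMod (Ideal.span {∏ i ∈ s, L i, G}) (L a) := by
      rw [span_prod_pair_eq_iInf h']
      refine IsRegularMod.iInf fun i => IsRegularMod.iInf fun hi => ?_
      exact h a (Finset.mem_insert_self a s) i (Finset.mem_insert_of_mem hi)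
        (by rintro rfl; exact ha hi)
    rw [Finset.prod_insert ha, span_mul_pair_eq_inf hE]
    have := IsRegularPairMod.liaison (B := ⊤) (Ideal.subset_span (by simp)) trivial hE
      (isRegularMod_top G) ih' (isRegularPairMod_top f g)
      (hreg a (Finset.mem_insert_self a s))
    rwa [inf_top_eq] at this

/-- The complete intersection of two products of forms is the union of the pairwise intersections:
one product is split first with the other generator a single form, and the resulting intersections
verify the regularity needed to split the other. -/
theorem span_prod_prod_eq_iInf {s t : Finset κ}
    (hs : ∀ i ∈ s, ∀ j ∈ s, ∀ l ∈ t, i ≠ j → IsRegularMod (Ideal.span {L j, L l}) (L i))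
    (ht : ∀ i ∈ t, ∀ j ∈ t, ∀ l ∈ s, i ≠ j → IsRegularMod (Ideal.span {L l, L j}) (L i)) :
    Ideal.span {∏ i ∈ s, L i, ∏ j ∈ t, L j} = ⨅ j ∈ t, ⨅ i ∈ s, Ideal.span {L i, L j} := by
  have hcol : ∀ j ∈ t, Ideal.span {L j, ∏ i ∈ s, L i} = ⨅ i ∈ s, Ideal.span {L i, L j} :=
    fun j hj => by
      rw [Set.pair_comm, span_prod_pair_eq_iInf fun i hi i' hi' => hs i hi i' hi' j hj]
  rw [Set.pair_comm, span_prod_pair_eq_iInf]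
  · exact iInf_congr fun j => iInf_congr fun hj => hcol j hj
  · intro i hi j hj hij
    rw [hcol j hj]
    exact IsRegularMod.iInf fun l => IsRegularMod.iInf fun hl => ht i hi j hj l hl hij

theorem IsRegularPairMod.span_prod_prod {s t : Finset κ} {f g : R}
    (hs : ∀ i ∈ s, ∀ j ∈ s, ∀ l ∈ t, i ≠ j → IsRegularMod (Ideal.span {L j, L l}) (L i))
    (ht : ∀ i ∈ t, ∀ j ∈ t, ∀ l ∈ s, i ≠ j → IsRegularMod (Ideal.span {L l, L j}) (L i))
    (hreg : ∀ i ∈ s, ∀ j ∈ t, IsRegularPairMod f g (Ideal.span {L i, L j})) :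
    IsRegularPairMod f g (Ideal.span {∏ i ∈ s, L i, ∏ j ∈ t, L j}) := by
  rw [Set.pair_comm]
  refine IsRegularPairMod.span_prod_pair ?_ ?_
  · intro i hi j hj hij
    rw [Set.pair_comm, span_prod_pair_eq_iInf fun i hi i' hi' => hs i hi i' hi' j hj]
    exact IsRegularMod.iInf fun l => IsRegularMod.iInf fun hl => ht i hi j hj l hl hij
  · intro j hj
    rw [Set.pair_comm]
    exact IsRegularPairMod.span_prod_pair (fun i hi i' hi' => hs i hi i' hi' j hj)
      fun i hi => hreg i hi j hj

/-! ### Liaison addition over a set of colours -/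

/-- The ideal obtained by liaison addition from a colouring `c` of the forms `L i` and one ideal
`B t` for each colour `t`. -/
def colouredIdeal {ι : Type*} (L : κ → R) (c : κ → ι) (B : ι → Ideal R) (T : Finset ι) : Ideal R :=
  (⨅ t ∈ T, B t) ⊓
    ⨅ (i : κ) (j : κ) (_ : c i ∈ T) (_ : c j ∈ T) (_ : c i ≠ c j), Ideal.span {L i, L j}

theorem mem_colouredIdeal {ι : Type*} {c : κ → ι} {B : ι → Ideal R} {T : Finset ι} {x : R} :
    x ∈ colouredIdeal L c B T ↔ (∀ t ∈ T, x ∈ B t) ∧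
      ∀ i j, c i ∈ T → c j ∈ T → c i ≠ c j → x ∈ Ideal.span {L i, L j} := by
  simp only [colouredIdeal, Ideal.mem_inf, Ideal.mem_iInf]

/-- Adding a colour `t` is one liaison addition: the product over the old colours and the product
over `t` generate the intersection of exactly those `(L i, L j)` that join an old colour to `t`. -/
theorem IsRegularPairMod.colouredIdeal [Fintype κ] {ι : Type*} [DecidableEq ι]
    {c : κ → ι} {B : ι → Ideal R} {f g : R}
    (hmem : ∀ t, ∏ i with c i = t, L i ∈ B t)
    (hB : ∀ i t, c i ≠ t → IsRegularMod (B t) (L i))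
    (hpair : ∀ i j l, c j ≠ c l → i ≠ j → i ≠ l → IsRegularMod (Ideal.span {L j, L l}) (L i))
    (hregB : ∀ t, IsRegularPairMod f g (B t))
    (hreg : ∀ i j, c i ≠ c j → IsRegularPairMod f g (Ideal.span {L i, L j})) (T : Finset ι) :
    IsRegularPairMod f g (colouredIdeal L c B T) := by
  induction T using Finset.induction_on with
  | empty =>
    convert isRegularPairMod_top f g
    simp [PlaneArrangement.colouredIdeal]
  | insert t T ht ih =>
    let U : Finset κ := {i | c i ∈ T}
    let V : Finset κ := {i | c i = t}
    have hU {i : κ} : i ∈ U ↔ c i ∈ T := by simp [U]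
    have hV {i : κ} : i ∈ V ↔ c i = t := by simp [V]
    have hUV {i j : κ} (hi : i ∈ U) (hj : j ∈ V) : c i ≠ c j := by
      rw [hV.1 hj]
      intro h
      exact ht (h ▸ hU.1 hi)
    have hs : ∀ i ∈ U, ∀ j ∈ U, ∀ l ∈ V, i ≠ j → IsRegularMod (Ideal.span {L j, L l}) (L i) :=
      fun i hi j hj l hl hij => hpair i j l (hUV hj hl) hij fun h => hUV hi hl (h ▸ rfl)
    have ht' : ∀ i ∈ V, ∀ j ∈ V, ∀ l ∈ U, i ≠ j → IsRegularMod (Ideal.span {L l, L j}) (L i) :=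
      fun i hi j hj l hl hij => hpair i l j (hUV hl hj) (fun h => hUV hl hi (h ▸ rfl)) hij
    -- This product is a multiple of the full product of every colour in `T`, and of each single
    -- factor whose colour is in `T`.
    have hUmem : ∏ i ∈ U, L i ∈ PlaneArrangement.colouredIdeal L c B T := by
      rw [mem_colouredIdeal]
      refine ⟨fun s hs => ?_, fun i j hi hj hij => ?_⟩
      · refine Ideal.mem_of_dvd _ (Finset.prod_dvd_prod_of_subset _ _ _ ?_) (hmem s)
        intro i hi
        rw [Finset.mem_filter] at hi
        exact hU.2 (hi.2 ▸ hs)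
      · exact Ideal.mem_of_dvd _ (Finset.dvd_prod_of_mem _ (hU.2 hi))
          (Ideal.subset_span (by simp))
    have := IsRegularPairMod.liaison (F := ∏ i ∈ V, L i) hUmem (hmem t)
      (IsRegularMod.prod fun i hi => ?_) (IsRegularMod.prod fun i hi => ?_) ih (hregB t)
      (Set.pair_comm _ _ ▸ IsRegularPairMod.span_prod_prod hs ht' fun i hi j hj =>
        hreg i j (hUV hi hj))
    · convert this using 1
      ext x
      rw [Set.pair_comm, span_prod_prod_eq_iInf hs ht']
      simp only [Ideal.mem_inf, mem_colouredIdeal, Ideal.mem_iInf, Finset.mem_insert]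
      constructor
      · rintro ⟨h₁, h₂⟩
        exact ⟨⟨⟨fun s hs => h₁ s (.inr hs), fun i j hi hj => h₂ i j (.inr hi) (.inr hj)⟩,
          h₁ t (.inl rfl)⟩, fun j hj i hi => h₂ i j (.inr (hU.1 hi)) (.inl (hV.1 hj)) (hUV hi hj)⟩
      · rintro ⟨⟨⟨h₁, h₂⟩, h₃⟩, h₄⟩
        refine ⟨?_, ?_⟩
        · rintro s (rfl | hs)
          exacts [h₃, h₁ s hs]
        · rintro i j (hi | hi) (hj | hj) hij
          · exact absurd (hi.trans hj.symm) hij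
          · rw [Set.pair_comm]
            exact h₄ i (hV.2 hi) j (hU.2 hj)
          · exact h₄ j (hV.2 hj) i (hU.2 hi)
          · exact h₂ i j hi hj hij
    · have hit : c i = t := hV.1 hi
      refine IsRegularMod.inf (IsRegularMod.iInf fun s => IsRegularMod.iInf fun hs =>
        hB i s fun h => ht ?_) ?_
      · rwa [← hit, h]
      · refine IsRegularMod.iInf fun j => IsRegularMod.iInf fun l => IsRegularMod.iInf fun hj =>
          IsRegularMod.iInf fun hl => IsRegularMod.iInf fun hjl => hpair i j l hjl ?_ ?_
        · rintro rfl
          exact ht (hit ▸ hj)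
        · rintro rfl
          exact ht (hit ▸ hl)
    · exact hB i t fun h => ht (h ▸ hU.1 hi)

end RegularPair

/-! ### Powers of the ideal of the variables -/

section IdealOfVars

open MvPolynomial

variable {σ T : Type*} [CommRing T]

/-- The constant term of `e` is nonzero. By induction on the degree, the coefficient of `e * x` at
`μ` is this constant term times that of `x`, since every other summand involves a lower coefficient
of `x`, already zero. -/
theorem isRegularMod_pow_idealOfVars [IsDomain T] {e : MvPolynomial σ T}
    (he : e ∉ idealOfVars σ T) (n : ℕ) : IsRegularMod (idealOfVars σ T ^ n) e := by
  classical
  have he0 : e.coeff 0 ≠ 0 := by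
    intro h0
    apply he
    rw [← pow_one (idealOfVars σ T), mem_pow_idealOfVars_iff']
    intro μ hμ
    rw [Nat.lt_one_iff, Finsupp.degree_eq_zero_iff] at hμ
    rw [hμ, h0]
  intro x hx
  rw [mem_pow_idealOfVars_iff'] at hx ⊢
  suffices ∀ m, ∀ μ : σ →₀ ℕ, μ.degree = m → m < n → x.coeff μ = 0 from
    fun μ hμ => this _ μ rfl hμ
  intro m
  induction m using Nat.strong_induction_on with
  | _ m ih =>
    intro μ hμ hm
    have h := hx μ (hμ ▸ hm)
    rw [coeff_mul, Finset.sum_eq_single (0, μ)] at h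
    · exact (mul_eq_zero.1 h).resolve_left he0
    · rintro ⟨ν, ν'⟩ hν hne
      rw [Finset.HasAntidiagonal.mem_antidiagonal] at hν
      have hν0 : ν ≠ 0 := by
        rintro rfl
        simp only [zero_add] at hν
        exact hne (by rw [hν])
      have hdeg : ν.degree + ν'.degree = m := by
        rw [← hμ, ← hν]
        simp
      have hpos : ν.degree ≠ 0 := fun h => hν0 ((Finsupp.degree_eq_zero_iff ν).1 h)
      simp only
      rw [ih ν'.degree (by omega) ν' rfl (by omega), mul_zero]
    · simp

theorem isPrime_idealOfVars [IsDomain T] : (idealOfVars σ T).IsPrime := by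
  refine ⟨?_, fun {x y} hxy => ?_⟩
  · rw [Ne, Ideal.eq_top_iff_one, ← pow_one (idealOfVars σ T), ← C_1, C_mem_pow_idealOfVars_iff]
    simp
  · by_contra! h
    refine h.2 ?_
    have := isRegularMod_pow_idealOfVars h.1 1 y
    rw [pow_one] at this
    exact this hxy

/-- The quotient by a power of the ideal of variables is free over `T` on the monomials of degree
below `n`, so regularity over `T` is inherited coefficient by coefficient. -/
theorem isRegularPairMod_pow_idealOfVars {a b : T} (ha : ∀ x, a * x = 0 → x = 0)
    (hb : ∀ x, a ∣ b * x → a ∣ x) (n : ℕ) :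
    IsRegularPairMod (C a) (C b) (idealOfVars σ T ^ n) := by
  classical
  constructor
  · intro x hx
    rw [mem_pow_idealOfVars_iff'] at hx ⊢
    intro μ hμ
    apply ha
    simpa using hx μ hμ
  · intro x y h
    rw [mem_pow_idealOfVars_iff'] at h
    -- Degrees at least `n` vanish in the quotient, so the choice there is arbitrary.
    have hdvd : ∀ μ : σ →₀ ℕ, ∃ z, μ.degree < n → x.coeff μ = a * z := by
      intro μ
      by_cases hμ : μ.degree < n
      · obtain ⟨z, hz⟩ := hb (x.coeff μ) ⟨y.coeff μ, by simpa [sub_eq_zero] using h μ hμ⟩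
        exact ⟨z, fun _ => hz⟩
      · exact ⟨0, fun h => absurd h hμ⟩
    choose z hz using hdvd
    refine ⟨∑ μ ∈ x.support, monomial μ (z μ), ?_⟩
    rw [mem_pow_idealOfVars_iff']
    intro μ hμ
    rw [coeff_sub, coeff_C_mul, coeff_sum]
    simp only [coeff_monomial, Finset.sum_ite_eq']
    split_ifs with hμs
    · rw [hz μ hμ, sub_self]
    · rw [notMem_support_iff.1 hμs, mul_zero, sub_self]

end IdealOfVars

/-! ### Coprimality of polynomials in different variables -/

section RelPrime

open MvPolynomial

variable {k : Type*} [Field k]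

/-- Degrees in each variable add over a domain, so a common divisor can involve neither `X i` nor `X
j` nor any other variable: it is a nonzero constant. -/
theorem isRelPrime_aeval_X {σ : Type*} {i j : σ} (hij : i ≠ j) {f g : Polynomial k} (hf : f ≠ 0)
    (hg : g ≠ 0) : IsRelPrime (Polynomial.aeval (X i : MvPolynomial σ k) f)
      (Polynomial.aeval (X j : MvPolynomial σ k) g) := by
  classical
  have hinj (i : σ) : Function.Injective (Polynomial.aeval (R := k) (X i : MvPolynomial σ k)) := by
    have := transcendental_X (R := k) i
    exact transcendental_iff_injective.1 this
  have hvars (i : σ) (f : Polynomial k) :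
      (Polynomial.aeval (X i : MvPolynomial σ k) f) ∈ supported k ({i} : Set σ) := by
    rw [supported_eq_adjoin_X, Set.image_singleton]
    exact Polynomial.aeval_mem_adjoin_singleton _ _
  have hdeg {i l : σ} (hil : l ≠ i) (f : Polynomial k) :
      degreeOf l (Polynomial.aeval (X i : MvPolynomial σ k) f) = 0 := by
    by_contra h
    exact hil (mem_supported.1 (hvars i f) (Finset.mem_coe.2 (mem_vars_iff_degreeOf_ne_zero.2 h)))
  intro h hhf hhg
  have hf' : Polynomial.aeval (X i : MvPolynomial σ k) f ≠ 0 := by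
    rw [Ne, map_eq_zero_iff _ (hinj i)]; exact hf
  have hg' : Polynomial.aeval (X j : MvPolynomial σ k) g ≠ 0 := by
    rw [Ne, map_eq_zero_iff _ (hinj j)]; exact hg
  have hle {p : MvPolynomial σ k} (hp : p ≠ 0) (hhp : h ∣ p) (l : σ)
      (hl : degreeOf l p = 0) : degreeOf l h = 0 := by
    obtain ⟨q, rfl⟩ := hhp
    rw [degreeOf_mul_eq (left_ne_zero_of_mul hp) (right_ne_zero_of_mul hp)] at hl
    omega
  have hzero (l : σ) : degreeOf l h = 0 := by
    by_cases hl : l = i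
    · exact hle hg' hhg l (hdeg (hl ▸ hij) g)
    · exact hle hf' hhf l (hdeg hl f)
  have hh0 : h ≠ 0 := by
    rintro rfl
    exact hf' (zero_dvd_iff.1 hhf)
  have hC : h = C (h.coeff 0) := by
    rw [← vars_eq_empty_iff_eq_C, Finset.eq_empty_iff_forall_notMem]
    exact fun l hl => mem_vars_iff_degreeOf_ne_zero.1 hl (hzero l)
  rw [hC]
  refine (isUnit_iff_ne_zero.2 fun h0 => hh0 ?_).map C
  rw [hC, h0, C_0]

end RelPrime


/-! ### Linear forms, coordinate changes and generic choices -/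

section LinearForms

open MvPolynomial

variable {k : Type*} [Field k]

/-- The linear form with given coefficients. -/
noncomputable def linearForm : (Fin 4 → k) →ₗ[k] CoordRing k :=
  Fintype.linearCombination k X

theorem linearForm_apply (u : Fin 4 → k) :
    linearForm u = ∑ i, u i • (X i : CoordRing k) := rfl

theorem linearForm_single (i : Fin 4) : linearForm (Pi.single i (1 : k)) = X i := by
  simp [linearForm]

theorem exists_linearForm_eq {F : CoordRing k} (hF : F.IsHomogeneous 1) :
    ∃ u, linearForm u = F := by
  rw [← mem_homogeneousSubmodule, homogeneousSubmodule_one_eq_span_X] at hF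
  exact (LinearMap.mem_range (f := linearForm)).1
    ((Fintype.range_linearCombination k (X : Fin 4 → CoordRing k)).symm ▸ hF)

theorem aeval_linearForm (E : (Fin 4 → k) →ₗ[k] Fin 4 → k) (u : Fin 4 → k) :
    aeval (fun i => linearForm (E (Pi.single i 1))) (linearForm u) = linearForm (E u) := by
  have hu : u = ∑ i, u i • Pi.single i (1 : k) := by
    ext j
    simp [Finset.sum_apply, Pi.single_apply]
  conv_rhs => rw [hu]
  simp [linearForm_apply u]

/-- The linear change of coordinates given by a linear automorphism of the space of linear
forms. -/
noncomputable def substitution (E : (Fin 4 → k) ≃ₗ[k] Fin 4 → k) : CoordRing k ≃ₐ[k] CoordRing k :=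
  AlgEquiv.ofAlgHom (aeval fun i => linearForm (E.toLinearMap (Pi.single i 1)))
    (aeval fun i => linearForm (E.symm.toLinearMap (Pi.single i 1)))
    (by
      ext1 i
      rw [AlgHom.comp_apply, aeval_X, aeval_linearForm]
      simp [linearForm_single])
    (by
      ext1 i
      rw [AlgHom.comp_apply, aeval_X, aeval_linearForm]
      simp [linearForm_single])

theorem substitution_linearForm (E : (Fin 4 → k) ≃ₗ[k] Fin 4 → k) (u : Fin 4 → k) :
    substitution E (linearForm u) = linearForm (E u) :=
  aeval_linearForm E.toLinearMap u

/-- Four independent linear forms are the variables of a polynomial ring, here regarded as a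
polynomial ring in the first two of them over the polynomial ring in the last two. -/
theorem exists_algEquiv_of_linearIndependent {v : Fin 4 → Fin 4 → k}
    (hv : LinearIndependent k v) :
    ∃ θ : CoordRing k ≃ₐ[k] MvPolynomial (Fin 2) (MvPolynomial (Fin 2) k),
      θ (linearForm (v 0)) = X 0 ∧ θ (linearForm (v 1)) = X 1 ∧
      θ (linearForm (v 2)) = C (X 0) ∧ θ (linearForm (v 3)) = C (X 1) := by
  let b := basisOfLinearIndependentOfCardEqFinrank hv (by simp)
  let e := substitution b.equivFun
  have he (i : Fin 4) : e (linearForm (v i)) = X i := by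
    have : v i = b i := by simp [b]
    rw [substitution_linearForm, this, b.equivFun_apply, b.repr_self, ← linearForm_single,
      Finsupp.single_eq_pi_single]
  refine ⟨(e.trans (renameEquiv k (finSumFinEquiv (m := 2) (n := 2)).symm)).trans
    (sumAlgEquiv k (Fin 2) (Fin 2)), ?_, ?_, ?_, ?_⟩
  · have : (finSumFinEquiv (m := 2) (n := 2)).symm 0 = .inl 0 := by decide
    simp [he, this]
  · have : (finSumFinEquiv (m := 2) (n := 2)).symm 1 = .inl 1 := by decide
    simp [he, this]
  · have : (finSumFinEquiv (m := 2) (n := 2)).symm 2 = .inr 0 := by decide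
    simp [he, this]
  · have : (finSumFinEquiv (m := 2) (n := 2)).symm 3 = .inr 1 := by decide
    simp [he, this]

theorem exists_notMem_of_ne_top [Infinite k] {E ι : Type*} [AddCommGroup E] [Module k E]
    [Finite ι] {W : ι → Submodule k E} (hW : ∀ i, W i ≠ ⊤) : ∃ x, ∀ i, x ∉ W i := by
  by_contra! h
  obtain ⟨i, hi⟩ := Subspace.exists_eq_top_of_iUnion_eq_univ (p := W)
    (Set.eq_univ_of_forall fun x => Set.mem_iUnion.2 (h x))
  exact hW i hi

theorem exists_notMem_span [Infinite k] {ι : Type*} [Finite ι] {m : ℕ} (hm : m < 4)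
    (w : ι → Fin m → Fin 4 → k) :
    ∃ x, ∀ i, x ∉ Submodule.span k (Set.range (w i)) := by
  refine exists_notMem_of_ne_top fun i h => ?_
  have := finrank_range_le_card (R := k) (w i)
  rw [Set.finrank, h, finrank_top] at this
  simp at this
  omega

/-- A vector space over an infinite field is not a finite union of proper subspaces. One choice of
`y`, `y'` thus serves all the lines at once, as liaison addition requires the same pair throughout.
-/
theorem exists_linearIndependent_extension [Infinite k] {ι : Type*} [Finite ι]
    (w : ι → Fin 2 → Fin 4 → k) (hw : ∀ i, LinearIndependent k (w i)) :
    ∃ y y' : Fin 4 → k, ∀ i, LinearIndependent k ![w i 0, w i 1, y, y'] := by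
  obtain ⟨y, hy⟩ := exists_notMem_span (by norm_num) w
  have h3 (i : ι) := LinearIndependent.finSnoc (hw i) (hy i)
  obtain ⟨y', hy'⟩ := exists_notMem_span (by norm_num) fun i => Fin.snoc (α := fun _ => Fin 4 → k) (w i) y
  have h4 (i : ι) := LinearIndependent.finSnoc (h3 i) (hy' i)
  refine ⟨y, y', fun i => ?_⟩
  have heq : ![w i 0, w i 1, y, y'] = Fin.snoc (α := fun _ => Fin 4 → k)
      (Fin.snoc (α := fun _ => Fin 4 → k) (w i) y) y' := by
    ext j : 1
    fin_cases j <;> rfl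
  rw [heq]
  exact h4 i

end LinearForms

/-! ### Ideals of lines and their powers -/

section LinePrime

open MvPolynomial

variable {k : Type*} [Field k] {u v y y' : Fin 4 → k}

/-- The ideal of the line cut out by two linear forms. -/
noncomputable def lineIdeal (u v : Fin 4 → k) : Ideal (CoordRing k) :=
  Ideal.span {linearForm u, linearForm v}

/-- In the coordinates `u, v` over `k[y, y']`, the line ideal becomes the ideal of the variables. -/
theorem exists_coordinates (h : LinearIndependent k ![u, v, y, y']) :
    ∃ θ : CoordRing k ≃ₐ[k] MvPolynomial (Fin 2) (MvPolynomial (Fin 2) k),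
      (∀ n x, x ∈ lineIdeal u v ^ n ↔ θ x ∈ idealOfVars (Fin 2) (MvPolynomial (Fin 2) k) ^ n) ∧
      (∀ x, x ∈ lineIdeal u v ↔ θ x ∈ idealOfVars (Fin 2) (MvPolynomial (Fin 2) k)) ∧
      θ (linearForm y) = C (X 0) ∧ θ (linearForm y') = C (X 1) := by
  obtain ⟨θ, h0, h1, h2, h3⟩ := exists_algEquiv_of_linearIndependent h
  simp only [Matrix.cons_val] at h0 h1 h2 h3
  have hmap : (lineIdeal u v).map θ = idealOfVars (Fin 2) (MvPolynomial (Fin 2) k) := by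
    rw [lineIdeal, Ideal.map_span, Set.image_pair, h0, h1, idealOfVars]
    congr 1
    ext x
    simp [Fin.exists_fin_two, eq_comm]
  have hpow (n : ℕ) (x) : x ∈ lineIdeal u v ^ n ↔
      θ x ∈ idealOfVars (Fin 2) (MvPolynomial (Fin 2) k) ^ n := by
    rw [← hmap, ← Ideal.map_pow, ← Ideal.mem_comap, Ideal.comap_map_of_bijective θ θ.bijective]
  refine ⟨θ, hpow, fun x => ?_, h2, h3⟩
  simpa only [pow_one] using hpow 1 x

theorem isRegularPairMod_lineIdeal_pow (h : LinearIndependent k ![u, v, y, y'])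
    {f g : Polynomial k} (hf : f ≠ 0) (hg : g ≠ 0) (n : ℕ) :
    IsRegularPairMod (Polynomial.aeval (linearForm y) f) (Polynomial.aeval (linearForm y') g)
      (lineIdeal u v ^ n) := by
  obtain ⟨θ, hpow, -, h2, h3⟩ := exists_coordinates h
  have hX {i : Fin 2} {f : Polynomial k} {z} (hz : θ z = C (X i)) : θ (Polynomial.aeval z f) =
      C (Polynomial.aeval (X i : MvPolynomial (Fin 2) k) f) := by
    rw [← Polynomial.aeval_algHom_apply, hz]
    exact Polynomial.aeval_algebraMap_apply (A := MvPolynomial (Fin 2) k) _ _ _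
  have hrel := isRelPrime_aeval_X (k := k) (show (0 : Fin 2) ≠ 1 by decide) hf hg
  have hne : Polynomial.aeval (X 0 : MvPolynomial (Fin 2) k) f ≠ 0 := fun h0 =>
    hf (transcendental_iff.1 (transcendental_X (R := k) (0 : Fin 2)) f h0)
  obtain ⟨hl, hr⟩ := isRegularPairMod_pow_idealOfVars (σ := Fin 2)
    (fun x hx => (mul_eq_zero.1 hx).resolve_left hne)
    (fun x hx => hrel.dvd_of_dvd_mul_left hx) n
  constructor
  · intro x hx
    rw [hpow, map_mul, hX h2] at hx
    exact (hpow n x).2 (hl _ hx)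
  · intro x z hx
    rw [hpow, map_sub, map_mul, map_mul, hX h2, hX h3] at hx
    obtain ⟨w, hw⟩ := hr _ _ hx
    refine ⟨θ.symm w, ?_⟩
    rw [hpow, map_sub, map_mul, hX h2, AlgEquiv.apply_symm_apply]
    exact hw

/-- The quotient by `q` is generated over `k` by the images of the four forms: two vanish and two
are algebraic. It is a domain integral over a field, hence a field. -/
theorem isMaximal_of_lineIdeal_le (h : LinearIndependent k ![u, v, y, y'])
    {f g : Polynomial k} (hf : f ≠ 0) (hg : g ≠ 0) {q : Ideal (CoordRing k)} [q.IsPrime]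
    (hq : lineIdeal u v ≤ q) (hfq : Polynomial.aeval (linearForm y) f ∈ q)
    (hgq : Polynomial.aeval (linearForm y') g ∈ q) : q.IsMaximal := by
  have hint {z : CoordRing k} {f : Polynomial k} (hf : f ≠ 0) (hz : Polynomial.aeval z f ∈ q) :
      IsIntegral k (Ideal.Quotient.mkₐ k q z) := by
    refine IsAlgebraic.isIntegral ⟨f, hf, ?_⟩
    rw [Polynomial.aeval_algHom_apply]
    exact Ideal.Quotient.eq_zero_iff_mem.2 hz
  have hzero {z : CoordRing k} (hz : z ∈ q) : IsIntegral k (Ideal.Quotient.mkₐ k q z) := by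
    have : Ideal.Quotient.mkₐ k q z = 0 := Ideal.Quotient.eq_zero_iff_mem.2 hz
    rw [this]
    exact isIntegral_zero
  have hle : Submodule.span k (Set.range ![u, v, y, y']) ≤
      (Subalgebra.toSubmodule (integralClosure k (CoordRing k ⧸ q))).comap
        ((Ideal.Quotient.mkₐ k q).toLinearMap ∘ₗ linearForm) := by
    rw [Submodule.span_le]
    rintro _ ⟨j, rfl⟩
    fin_cases j
    · exact hzero (hq (Ideal.subset_span (by simp)))
    · exact hzero (hq (Ideal.subset_span (by simp)))
    · exact hint hf hfq
    · exact hint hg hgq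
  rw [h.span_eq_top_of_card_eq_finrank (by simp)] at hle
  have hX (i : Fin 4) : IsIntegral k (Ideal.Quotient.mkₐ k q (X i)) := by
    rw [← linearForm_single]
    exact hle (Submodule.mem_top (x := (Pi.single i 1 : Fin 4 → k)))
  have hall : (⊤ : Subalgebra k (CoordRing k)) ≤
      (integralClosure k (CoordRing k ⧸ q)).comap (Ideal.Quotient.mkₐ k q) := by
    rw [← adjoin_range_X, Algebra.adjoin_le_iff]
    rintro _ ⟨i, rfl⟩
    exact hX i
  have : Algebra.IsIntegral k (CoordRing k ⧸ q) := by
    refine ⟨fun z => ?_⟩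
    obtain ⟨x, rfl⟩ := Ideal.Quotient.mk_surjective z
    exact hall (Algebra.mem_top (x := x))
  exact Ideal.Quotient.maximal_of_isField _
    (isField_of_isIntegral_of_isField' (Field.toIsField k))

variable [Infinite k]

theorem exists_coordinates_of_pair (h : LinearIndependent k ![u, v]) :
    ∃ y y', LinearIndependent k ![u, v, y, y'] := by
  obtain ⟨y, y', hy⟩ := exists_linearIndependent_extension (ι := Unit) (fun _ => ![u, v]) fun _ => h
  exact ⟨y, y', hy ()⟩

theorem isPrime_lineIdeal (h : LinearIndependent k ![u, v]) : (lineIdeal u v).IsPrime := by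
  obtain ⟨y, y', hy⟩ := exists_coordinates_of_pair h
  obtain ⟨θ, -, hθ, -⟩ := exists_coordinates hy
  have : lineIdeal u v = (idealOfVars (Fin 2) (MvPolynomial (Fin 2) k)).comap θ := by
    ext x
    rw [hθ, Ideal.mem_comap]
  have := isPrime_idealOfVars (σ := Fin 2) (T := MvPolynomial (Fin 2) k)
  rw [‹lineIdeal u v = _›]
  exact Ideal.comap_isPrime θ _

theorem isRegularMod_lineIdeal_pow (h : LinearIndependent k ![u, v]) {e : CoordRing k}
    (he : e ∉ lineIdeal u v) (n : ℕ) : IsRegularMod (lineIdeal u v ^ n) e := by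
  obtain ⟨y, y', hy⟩ := exists_coordinates_of_pair h
  obtain ⟨θ, hpow, hθ, -⟩ := exists_coordinates hy
  rw [hθ] at he
  intro x hx
  rw [hpow, map_mul] at hx
  exact (hpow n x).2 (isRegularMod_pow_idealOfVars he n _ hx)

/-- For the forward direction, the `y`, `y'` part of `w` becomes a constant of the polynomial ring
over `k[y, y']`, and a constant lies in the ideal of the variables only if it is zero. -/
theorem linearForm_mem_lineIdeal_iff (h : LinearIndependent k ![u, v]) {w : Fin 4 → k} :
    linearForm w ∈ lineIdeal u v ↔ w ∈ Submodule.span k {u, v} := by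
  constructor
  · intro hw
    obtain ⟨y, y', hy⟩ := exists_coordinates_of_pair h
    have hspan := hy.span_eq_top_of_card_eq_finrank (by simp)
    obtain ⟨c, hc⟩ := (Submodule.mem_span_range_iff_exists_fun k).1
      (hspan ▸ Submodule.mem_top (x := w))
    simp only [Fin.sum_univ_four, Matrix.cons_val] at hc
    obtain ⟨θ, -, hθ, h2, h3⟩ := exists_coordinates hy
    have hmem : C (c 2 • X 0 + c 3 • X 1) ∈
        idealOfVars (Fin 2) (MvPolynomial (Fin 2) k) := by
      have h23 : linearForm (c 2 • y + c 3 • y') ∈ lineIdeal u v := by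
        have : c 2 • y + c 3 • y' = w - (c 0 • u + c 1 • v) := by
          rw [← hc]; abel
        rw [this, map_sub, map_add, map_smul, map_smul]
        refine Ideal.sub_mem _ hw (Ideal.add_mem _ ?_ ?_)
        · exact Submodule.smul_of_tower_mem _ _ (Ideal.subset_span (by simp))
        · exact Submodule.smul_of_tower_mem _ _ (Ideal.subset_span (by simp))
      rw [hθ, map_add, map_smul, map_smul, map_add, map_smul, map_smul, h2, h3] at h23
      convert h23 using 1
      simp only [map_add, Algebra.smul_def, map_mul]
      rfl
    rw [← pow_one (idealOfVars _ _), C_mem_pow_idealOfVars_iff] at hmem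
    have hz := hmem.resolve_right one_ne_zero
    have hc2 : c 2 = 0 := by
      have := congrArg (coeff (Finsupp.single 0 1)) hz
      simpa [coeff_X, Finsupp.single_left_inj] using this
    have hc3 : c 3 = 0 := by
      have := congrArg (coeff (Finsupp.single 1 1)) hz
      simpa [coeff_X, Finsupp.single_left_inj] using this
    rw [Submodule.mem_span_pair]
    exact ⟨c 0, c 1, by rw [← hc, hc2, hc3]; simp⟩
  · intro hw
    obtain ⟨a, b, rfl⟩ := Submodule.mem_span_pair.1 hw
    rw [map_add, map_smul, map_smul]
    exact Ideal.add_mem _ (Submodule.smul_of_tower_mem _ _ (Ideal.subset_span (by simp)))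
      (Submodule.smul_of_tower_mem _ _ (Ideal.subset_span (by simp)))

theorem lineIdeal_eq_of_mem {u' v' : Fin 4 → k} (h : LinearIndependent k ![u, v])
    (h' : LinearIndependent k ![u', v']) (hu : linearForm u' ∈ lineIdeal u v)
    (hv : linearForm v' ∈ lineIdeal u v) : lineIdeal u' v' = lineIdeal u v := by
  rw [linearForm_mem_lineIdeal_iff h] at hu hv
  have hspan : Submodule.span k {u', v'} = Submodule.span k {u, v} := by
    apply Submodule.eq_of_le_of_finrank_eq
    · rw [Submodule.span_le, Set.insert_subset_iff, Set.singleton_subset_iff]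
      exact ⟨hu, hv⟩
    · have h1 := finrank_span_eq_card h
      have h2 := finrank_span_eq_card h'
      rw [Matrix.range_cons_cons_empty] at h1 h2
      rw [h1, h2]
  apply le_antisymm
  · rw [lineIdeal, Ideal.span_le, Set.insert_subset_iff, Set.singleton_subset_iff]
    exact ⟨(linearForm_mem_lineIdeal_iff h).2 hu, (linearForm_mem_lineIdeal_iff h).2 hv⟩
  · rw [lineIdeal, Ideal.span_le, Set.insert_subset_iff, Set.singleton_subset_iff]
    exact ⟨(linearForm_mem_lineIdeal_iff h').2 (hspan ▸ Submodule.subset_span (by simp)),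
      (linearForm_mem_lineIdeal_iff h').2 (hspan ▸ Submodule.subset_span (by simp))⟩

end LinePrime

/-! ### A Cohen–Macaulay criterion -/

section CohenMacaulay

open RingTheory.Sequence

theorem isWeaklyRegular_pair {A : Type*} [CommRing A] {a b : A} (ha : ∀ x, a * x = 0 → x = 0)
    (hb : ∀ x y, b * x = a * y → a ∣ x) : IsWeaklyRegular A [a, b] := by
  rw [isWeaklyRegular_cons_iff, isWeaklyRegular_singleton_iff]
  refine ⟨IsSMulRegular.of_right_eq_zero_of_smul ha, IsSMulRegular.of_right_eq_zero_of_smul ?_⟩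
  intro x hx
  obtain ⟨x, rfl⟩ := Submodule.Quotient.mk_surjective _ x
  rw [← Submodule.Quotient.mk_smul, Submodule.Quotient.mk_eq_zero,
    Submodule.mem_smul_pointwise_iff_exists] at hx
  obtain ⟨y, -, hy⟩ := hx
  obtain ⟨z, rfl⟩ := hb x y hy.symm
  rw [Submodule.Quotient.mk_eq_zero]
  exact Submodule.smul_mem_pointwise_smul z a ⊤ trivial

theorem isMaximal_of_comap_of_surjective {A B : Type*} [CommRing A] [CommRing B] {f : A →+* B}
    (hf : Function.Surjective f) {Q : Ideal B} (h : (Q.comap f).IsMaximal) : Q.IsMaximal := by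
  have := Ideal.map_eq_top_or_isMaximal_of_surjective f hf h
  rw [Ideal.map_comap_of_surjective f hf] at this
  refine this.resolve_left ?_
  rintro rfl
  exact h.ne_top Ideal.comap_top

/-- Weak regularity becomes regularity after localizing at a maximal ideal containing the pair. The
maximality condition makes the quotient by the pair zero-dimensional. -/
theorem isCohenMacaulayRing_quotient {R : Type*} [CommRing R] [IsNoetherianRing R] {I : Ideal R}
    (h : ∀ M : Ideal R, M.IsMaximal → I ≤ M → ∃ f ∈ M, ∃ g ∈ M, IsRegularPairMod f g I ∧
      ∀ q : Ideal R, q.IsPrime → I ≤ q → f ∈ q → g ∈ q → q.IsMaximal) :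
    IsCohenMacaulayRing (R ⧸ I) := by
  refine ⟨inferInstance, fun m hm => ⟨inferInstance, ?_⟩⟩
  let π := Ideal.Quotient.mk I
  have hπ : Function.Surjective π := Ideal.Quotient.mk_surjective
  have hIπ (q : Ideal (R ⧸ I)) : I ≤ q.comap π := by
    intro x hx
    rw [Ideal.mem_comap, Ideal.Quotient.eq_zero_iff_mem.2 hx]
    exact q.zero_mem
  obtain ⟨f, hf, g, hg, hreg, hmax⟩ := h (m.comap π) (Ideal.comap_isMaximal_of_surjective π hπ)
    (hIπ m)
  have hweak : IsWeaklyRegular (R ⧸ I) [π f, π g] := by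
    apply isWeaklyRegular_pair
    · intro x hx
      obtain ⟨x, rfl⟩ := hπ x
      rw [← map_mul, Ideal.Quotient.eq_zero_iff_mem] at hx
      exact Ideal.Quotient.eq_zero_iff_mem.2 (hreg.left x hx)
    · intro x y hxy
      obtain ⟨x, rfl⟩ := hπ x
      obtain ⟨y, rfl⟩ := hπ y
      rw [← map_mul, ← map_mul, Ideal.Quotient.eq] at hxy
      obtain ⟨z, hz⟩ := hreg.right x y hxy
      exact ⟨π z, by rw [← map_mul]; exact Ideal.Quotient.eq.2 hz⟩
  have hregular := hweak.isRegular_of_isLocalization_of_mem (Localization.AtPrime m) m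
    (by simpa using ⟨hf, hg⟩)
  refine ⟨_, hregular, ?_⟩
  -- The dimension drops by exactly the length of a regular sequence, so it remains to show that the
  -- quotient has dimension 0.
  rw [← ringKrullDim_add_length_eq_ringKrullDim_of_isRegular _ hregular]
  set rs := [π f, π g].map (algebraMap (R ⧸ I) (Localization.AtPrime m)) with hrs
  have hne : Ideal.ofList rs ≠ ⊤ := by
    intro htop
    have := hregular.top_ne_smul
    rw [htop] at this
    simp at this
  have : Nontrivial (Localization.AtPrime m ⧸ Ideal.ofList rs) := Ideal.Quotient.nontrivial_iff.2 hne
  have hzero : Ring.KrullDimLE 0 (Localization.AtPrime m ⧸ Ideal.ofList rs) := by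
    refine Ring.KrullDimLE.mk₀ fun Q hQ => ?_
    let Q' : Ideal (Localization.AtPrime m) := Q.comap (Ideal.Quotient.mk _)
    have hQ' : Q'.IsPrime := Ideal.comap_isPrime _ _
    have hmem {r : R ⧸ I} (hr : r ∈ [π f, π g]) :
        r ∈ Q'.comap (algebraMap (R ⧸ I) (Localization.AtPrime m)) := by
      rw [Ideal.mem_comap, Ideal.mem_comap]
      rw [Ideal.Quotient.eq_zero_iff_mem.2]
      · exact Q.zero_mem
      · exact Ideal.subset_span (List.mem_map_of_mem hr)
    have hcomax := hmax ((Q'.comap (algebraMap (R ⧸ I) (Localization.AtPrime m))).comap π)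
      (Ideal.comap_isPrime _ _) (hIπ _) (hmem (by simp)) (hmem (by simp))
    have hle : Q'.comap (algebraMap (R ⧸ I) (Localization.AtPrime m)) ≤ m := by
      intro x hx
      by_contra hxm
      exact hQ'.ne_top (Ideal.eq_top_of_isUnit_mem _ hx
        (IsLocalization.map_units (Localization.AtPrime m) (⟨x, hxm⟩ : m.primeCompl)))
    have hmaxQ : (Q'.comap (algebraMap (R ⧸ I) (Localization.AtPrime m))).IsMaximal :=
      isMaximal_of_comap_of_surjective hπ hcomax
    have heq := hmaxQ.eq_of_le hm.ne_top hle
    have hQ'eq : Q' = IsLocalRing.maximalIdeal (Localization.AtPrime m) := by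
      rw [← Localization.AtPrime.map_eq_maximalIdeal]
      conv_rhs => arg 2; rw [← heq]
      rw [IsLocalization.map_under m.primeCompl]
    have : Q'.IsMaximal := hQ'eq ▸ inferInstance
    exact isMaximal_of_comap_of_surjective Ideal.Quotient.mk_surjective this
  rw [ringKrullDimZero_iff_ringKrullDim_eq_zero.1 hzero, zero_add]
  rfl


end CohenMacaulay

/-! ### Minimal primes of the Jacobian ideal -/

section Jacobian

open MvPolynomial

variable {k : Type*} [Field k] {d : ℕ}

theorem arrangementIdeal_le_iff {L : Fin d → CoordRing k} {q : Ideal (CoordRing k)} :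
    arrangementIdeal L ≤ q ↔ ∀ j, pderiv j (∏ i, L i) ∈ q := by
  rw [arrangementIdeal, jacobianIdeal, Ideal.span_le, Set.range_subset_iff]
  rfl

theorem arrangementIdeal_le_of_mem {L : Fin d → CoordRing k} {q : Ideal (CoordRing k)} {i j : Fin d}
    (hij : i ≠ j) (hi : L i ∈ q) (hj : L j ∈ q) : arrangementIdeal L ≤ q := by
  rw [arrangementIdeal_le_iff]
  intro l
  rw [← Finset.mul_prod_erase _ _ (Finset.mem_univ i), Derivation.leibniz, smul_eq_mul, smul_eq_mul]
  have : ∏ x ∈ Finset.univ.erase i, L x ∈ q :=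
    Ideal.mem_of_dvd _ (Finset.dvd_prod_of_mem _ (Finset.mem_erase.2 ⟨hij.symm, Finset.mem_univ j⟩)) hj
  exact q.add_mem (q.mul_mem_right _ hi) (q.mul_mem_right _ this)

/-- Euler's formula gives `d • F ∈ q`, and `d` is invertible, so some factor `L i` lies in `q`.
Choosing `j` with nonzero `j`-th coefficient of `L i`, the derivative of `F` in direction `j` is,
modulo `L i`, a unit times the product of the other factors. -/
theorem exists_pair_mem_of_arrangementIdeal_le [CharZero k] {l : Fin d → Fin 4 → k}
    (hl : ∀ i, l i ≠ 0) (hd : d ≠ 0) {q : Ideal (CoordRing k)} [hq : q.IsPrime]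
    (h : arrangementIdeal (fun i => linearForm (l i)) ≤ q) :
    ∃ i j, i ≠ j ∧ linearForm (l i) ∈ q ∧ linearForm (l j) ∈ q := by
  rw [arrangementIdeal_le_iff] at h
  have hhom (u : Fin 4 → k) : (linearForm u).IsHomogeneous 1 := by
    rw [linearForm_apply, ← mem_homogeneousSubmodule]
    exact Submodule.sum_mem _ fun i _ => Submodule.smul_mem _ _ (isHomogeneous_X k i)
  have hF : ∏ i, linearForm (l i) ∈ q := by
    have hprod := IsHomogeneous.prod Finset.univ (fun i => linearForm (l i)) (fun _ => 1)
      fun i _ => hhom (l i)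
    have heuler := hprod.sum_X_mul_pderiv
    have hmem : d • ∏ i, linearForm (l i) ∈ q := by
      simp only [Finset.sum_const, Finset.card_univ, Fintype.card_fin, smul_eq_mul, mul_one]
        at heuler
      rw [← heuler]
      exact q.sum_mem fun i _ => q.mul_mem_left _ (h i)
    have hunit : ∏ i, linearForm (l i) = C ((d : k)⁻¹) * d • ∏ i, linearForm (l i) := by
      rw [nsmul_eq_mul, ← mul_assoc, ← map_natCast (C : k →+* CoordRing k), ← C_mul,
        inv_mul_cancel₀ (Nat.cast_ne_zero.2 hd), C_1, one_mul]
    rw [hunit]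
    exact q.mul_mem_left _ hmem
  obtain ⟨i, -, hi⟩ := hq.prod_mem_iff.1 hF
  obtain ⟨j, hj⟩ := Function.ne_iff.1 (hl i)
  have hder := h j
  rw [← Finset.mul_prod_erase _ _ (Finset.mem_univ i), Derivation.leibniz, smul_eq_mul, smul_eq_mul,
    Ideal.add_mem_iff_right _ (q.mul_mem_right _ hi)] at hder
  have hpd : pderiv j (linearForm (l i)) = C (l i j) := by
    rw [linearForm_apply, map_sum, Finset.sum_eq_single j]
    · rw [Derivation.map_smul, pderiv_X_self, smul_eq_C_mul, mul_one]
    · intro m _ hm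
      rw [Derivation.map_smul, pderiv_X_of_ne hm, smul_zero]
    · simp
  rw [hpd] at hder
  rcases hq.mem_or_mem hder with h' | h'
  · obtain ⟨m, hm, hm'⟩ := hq.prod_mem_iff.1 h'
    exact ⟨i, m, (Finset.mem_erase.1 hm).1.symm, hi, hm'⟩
  · exact absurd (Ideal.eq_top_of_isUnit_mem _ h' ((isUnit_iff_ne_zero.2 hj).map C)) hq.ne_top

theorem mem_minimalPrimes_arrangementIdeal_iff [CharZero k] {l : Fin d → Fin 4 → k}
    (hl : ∀ i, l i ≠ 0) (hli : ∀ i j, i ≠ j → LinearIndependent k ![l i, l j]) (hd : d ≠ 0)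
    {p : Ideal (CoordRing k)} :
    p ∈ (arrangementIdeal fun i => linearForm (l i)).minimalPrimes ↔
      ∃ i j, i ≠ j ∧ p = lineIdeal (l i) (l j) := by
  have hle {i j : Fin d} (hij : i ≠ j) :
      arrangementIdeal (fun i => linearForm (l i)) ≤ lineIdeal (l i) (l j) :=
    arrangementIdeal_le_of_mem hij (Ideal.subset_span (by simp)) (Ideal.subset_span (by simp))
  have hlow {q : Ideal (CoordRing k)} {i j : Fin d} (hi : linearForm (l i) ∈ q)
      (hj : linearForm (l j) ∈ q) : lineIdeal (l i) (l j) ≤ q := by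
    rw [lineIdeal, Ideal.span_le, Set.insert_subset_iff, Set.singleton_subset_iff]
    exact ⟨hi, hj⟩
  constructor
  · rintro ⟨⟨hp, hJ⟩, hmin⟩
    obtain ⟨i, j, hij, hi, hj⟩ := exists_pair_mem_of_arrangementIdeal_le hl hd hJ
    exact ⟨i, j, hij, le_antisymm
      (hmin ⟨isPrime_lineIdeal (hli i j hij), hle hij⟩ (hlow hi hj)) (hlow hi hj)⟩
  · rintro ⟨i, j, hij, rfl⟩
    refine ⟨⟨isPrime_lineIdeal (hli i j hij), hle hij⟩, ?_⟩
    rintro q ⟨hq, hJ⟩ hqp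
    obtain ⟨m, n, hmn, hm, hn⟩ := exists_pair_mem_of_arrangementIdeal_le hl hd hJ
    rw [← lineIdeal_eq_of_mem (hli i j hij) (hli m n hmn) (hqp hm) (hqp hn)]
    exact hlow hm hn

end Jacobian

/-! ### Colouring the planes and assembling the proof -/

section Main

open MvPolynomial

variable {k : Type*} [Field k] {d : ℕ}

/-- By the Nullstellensatz the residue field is finite over `k`; `f` is the minimal polynomial of
the class of `z`. -/
theorem exists_aeval_mem_of_isMaximal {M : Ideal (CoordRing k)} (hM : M.IsMaximal)
    (z : CoordRing k) : ∃ f : Polynomial k, f ≠ 0 ∧ Polynomial.aeval z f ∈ M := by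
  let := Ideal.Quotient.field M
  have : Module.Finite k (CoordRing k ⧸ M) := finite_of_finite_type_of_isJacobsonRing _ _
  have halg : IsIntegral k (Ideal.Quotient.mkₐ k M z) := Algebra.IsIntegral.isIntegral _
  refine ⟨minpoly k (Ideal.Quotient.mkₐ k M z), minpoly.ne_zero halg, ?_⟩
  have := minpoly.aeval k (Ideal.Quotient.mkₐ k M z)
  rw [Polynomial.aeval_algHom_apply] at this
  exact Ideal.Quotient.eq_zero_iff_mem.1 this

theorem two_le_numFactors {L : Fin d → CoordRing k} {p : Ideal (CoordRing k)} {i j : Fin d}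
    (hij : i ≠ j) (hi : L i ∈ p) (hj : L j ∈ p) : 2 ≤ numFactors L p := by
  rw [← Set.ncard_pair hij]
  refine Set.ncard_le_ncard ?_ (Set.toFinite _)
  rintro _ (rfl | rfl)
  exacts [hi, hj]

theorem three_le_numFactors {L : Fin d → CoordRing k} {p : Ideal (CoordRing k)} {i j m : Fin d}
    (hij : i ≠ j) (him : i ≠ m) (hjm : j ≠ m) (hi : L i ∈ p) (hj : L j ∈ p) (hm : L m ∈ p) :
    3 ≤ numFactors L p := by
  rw [← Set.ncard_eq_three.2 ⟨i, j, m, hij, him, hjm, rfl⟩]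
  refine Set.ncard_le_ncard ?_ (Set.toFinite _)
  rintro _ (rfl | rfl | rfl)
  exacts [hi, hj, hm]

theorem prod_mem_pow_numFactors (L : Fin d → CoordRing k) (p : Ideal (CoordRing k))
    {s : Finset (Fin d)} (hs : ∀ i, i ∈ s ↔ L i ∈ p) : ∏ i ∈ s, L i ∈ p ^ numFactors L p := by
  have hcard : numFactors L p = s.card := by
    rw [numFactors, ← Set.ncard_coe_finset]
    congr 1
    ext i
    simp [hs]
  rw [hcard, ← Finset.prod_const]
  exact Ideal.prod_mem_prod fun i hi => (hs i).1 hi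

theorem mem_fatIdeal {L : Fin d → CoordRing k} {b : Ideal (CoordRing k) → ℕ} {x : CoordRing k} :
    x ∈ fatIdeal L b ↔ ∀ p ∈ (arrangementIdeal L).minimalPrimes, x ∈ p ^ b p := by
  simp only [fatIdeal, Ideal.mem_iInf]

theorem exists_minimalPrime_le_of_fatIdeal_le {L : Fin d → CoordRing k}
    {b : Ideal (CoordRing k) → ℕ} {q : Ideal (CoordRing k)} (hq : q.IsPrime)
    (h : fatIdeal L b ≤ q) : ∃ p ∈ (arrangementIdeal L).minimalPrimes, p ≤ q := by
  have hfin := (arrangementIdeal L).finite_minimalPrimes_of_isNoetherianRing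
  have hinf : hfin.toFinset.inf (fun p => p ^ b p) ≤ q := by
    refine le_trans ?_ h
    rw [fatIdeal]
    refine le_iInf₂ fun p hp => Finset.inf_le (hfin.mem_toFinset.2 hp)
  obtain ⟨p, hp, hpq⟩ := (Ideal.IsPrime.inf_le' hq).1 hinf
  exact ⟨p, hfin.mem_toFinset.1 hp, hq.le_of_pow_le hpq⟩

open Classical in
/-- Two factors have the same colour if they are equal or lie in a common minimal prime of the
Jacobian ideal that contains at least three factors. -/
noncomputable def colour (L : Fin d → CoordRing k) (i : Fin d) : Ideal (CoordRing k) ⊕ Fin d :=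
  if h : ∃ p ∈ (arrangementIdeal L).minimalPrimes, 3 ≤ numFactors L p ∧ L i ∈ p then .inl h.choose
  else .inr i

open Classical in
/-- The contribution of each colour to the ideal `fatIdeal L b`. -/
noncomputable def colourIdeal (L : Fin d → CoordRing k) (b : Ideal (CoordRing k) → ℕ) :
    Ideal (CoordRing k) ⊕ Fin d → Ideal (CoordRing k)
  | .inl p => if p ∈ (arrangementIdeal L).minimalPrimes ∧ 3 ≤ numFactors L p then p ^ b p else ⊤
  | .inr _ => ⊤

/-- The hypothesis on factors leaves only one candidate for the prime chosen in `colour`. -/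
theorem colour_eq_inl_iff {L : Fin d → CoordRing k}
    (hfactor : ∀ i : Fin d, ∀ p ∈ (arrangementIdeal L).minimalPrimes,
      ∀ q ∈ (arrangementIdeal L).minimalPrimes, 3 ≤ numFactors L p → 3 ≤ numFactors L q →
        L i ∈ p → L i ∈ q → p = q) {i : Fin d} {p : Ideal (CoordRing k)} :
    colour L i = .inl p ↔
      p ∈ (arrangementIdeal L).minimalPrimes ∧ 3 ≤ numFactors L p ∧ L i ∈ p := by
  unfold colour
  split_ifs with h
  · obtain ⟨h₁, h₂, h₃⟩ := h.choose_spec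
    rw [Sum.inl.injEq]
    constructor
    · intro hp
      exact hp ▸ ⟨h₁, h₂, h₃⟩
    · rintro ⟨hp₁, hp₂, hp₃⟩
      exact hfactor i _ h₁ _ hp₁ h₂ hp₂ h₃ hp₃
  · simp only [false_iff]
    exact fun hp => h ⟨p, hp⟩

theorem eq_of_colour_eq_inr {L : Fin d → CoordRing k} {i j : Fin d} (h : colour L i = .inr j) :
    i = j := by
  unfold colour at h
  split_ifs at h
  exact Sum.inr.inj h

theorem isCohenMacaulayRing_quotient_fatIdeal [CharZero k] {l : Fin d → Fin 4 → k}
    (hl : ∀ i, l i ≠ 0) (hli : ∀ i j, i ≠ j → LinearIndependent k ![l i, l j]) (hd : d ≠ 0)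
    {L : Fin d → CoordRing k} (hL : ∀ i, L i = linearForm (l i)) (b : Ideal (CoordRing k) → ℕ)
    (hb_two : ∀ p ∈ (arrangementIdeal L).minimalPrimes, numFactors L p = 2 → b p = 1)
    (hb_other : ∀ p ∈ (arrangementIdeal L).minimalPrimes,
      numFactors L p ≠ 2 → b p ≤ numFactors L p)
    (hfactor : ∀ i : Fin d, ∀ p ∈ (arrangementIdeal L).minimalPrimes,
      ∀ q ∈ (arrangementIdeal L).minimalPrimes, 3 ≤ numFactors L p → 3 ≤ numFactors L q →
        L i ∈ p → L i ∈ q → p = q) :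
    IsCohenMacaulayRing (CoordRing k ⧸ fatIdeal L b) := by
  classical
  have hmin {p : Ideal (CoordRing k)} : p ∈ (arrangementIdeal L).minimalPrimes ↔
      ∃ i j, i ≠ j ∧ p = lineIdeal (l i) (l j) := by
    rw [show L = fun i => linearForm (l i) from funext hL]
    exact mem_minimalPrimes_arrangementIdeal_iff hl hli hd
  have hspan (i j : Fin d) : Ideal.span {L i, L j} = lineIdeal (l i) (l j) := by
    rw [hL, hL, lineIdeal]
  have hleft (i j : Fin d) : L i ∈ lineIdeal (l i) (l j) := by
    rw [← hspan]; exact Ideal.subset_span (by simp)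
  have hright (i j : Fin d) : L j ∈ lineIdeal (l i) (l j) := by
    rw [← hspan]; exact Ideal.subset_span (by simp)
  have hcol {i : Fin d} {p : Ideal (CoordRing k)} : colour L i = .inl p ↔
      p ∈ (arrangementIdeal L).minimalPrimes ∧ 3 ≤ numFactors L p ∧ L i ∈ p :=
    colour_eq_inl_iff hfactor
  have hne {i j : Fin d} (h : colour L i ≠ colour L j) : i ≠ j := fun hij => h (hij ▸ rfl)
  -- Lines through factors of different colours lie on exactly two of the planes.
  have hsimple {i j : Fin d} (h : colour L i ≠ colour L j) :
      ¬ 3 ≤ numFactors L (lineIdeal (l i) (l j)) := by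
    intro h3
    have hp := hmin.2 ⟨i, j, hne h, rfl⟩
    exact h ((hcol.2 ⟨hp, h3, hleft i j⟩).trans (hcol.2 ⟨hp, h3, hright i j⟩).symm)
  have hone {i j : Fin d} (hij : i ≠ j) (h : ¬ 3 ≤ numFactors L (lineIdeal (l i) (l j))) :
      b (lineIdeal (l i) (l j)) = 1 := by
    refine hb_two _ (hmin.2 ⟨i, j, hij, rfl⟩) ?_
    have := two_le_numFactors hij (hleft i j) (hright i j)
    omega
  have hfat : fatIdeal L b =
      colouredIdeal L (colour L) (colourIdeal L b) (Finset.univ.image (colour L)) := by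
    ext x
    rw [mem_fatIdeal, mem_colouredIdeal]
    constructor
    · intro hx
      refine ⟨?_, fun i j _ _ hij => ?_⟩
      · rintro (p | j) -
        · rw [colourIdeal]
          split_ifs with hp
          · exact hx p hp.1
          · trivial
        · trivial
      · have := hx _ (hmin.2 ⟨i, j, hne hij, rfl⟩)
        rwa [hone (hne hij) (hsimple hij), pow_one, ← hspan] at this
    · rintro ⟨hx, hx'⟩ p hp
      obtain ⟨i, j, hij, rfl⟩ := hmin.1 hp
      by_cases h3 : 3 ≤ numFactors L (lineIdeal (l i) (l j))
      · have hi := hcol.2 ⟨hp, h3, hleft i j⟩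
        have := hx (.inl (lineIdeal (l i) (l j)))
          (Finset.mem_image.2 ⟨i, Finset.mem_univ i, hi⟩)
        rwa [colourIdeal, if_pos ⟨hp, h3⟩] at this
      · rw [hone hij h3, pow_one, ← hspan]
        refine hx' i j (Finset.mem_image_of_mem _ (Finset.mem_univ i))
          (Finset.mem_image_of_mem _ (Finset.mem_univ j)) fun hc => ?_
        -- Two distinct factors of equal colour both lie in a multiple prime, which must then be the
        -- line they span; but that line is simple here.
        rcases hci : colour L i with p | m
        · obtain ⟨hp, hp3, hip⟩ := hcol.1 hci
          obtain ⟨-, -, hjp⟩ := hcol.1 (hc ▸ hci)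
          obtain ⟨i', j', hij', rfl⟩ := hmin.1 hp
          rw [hL] at hip hjp
          exact h3 (lineIdeal_eq_of_mem (hli i' j' hij') (hli i j hij) hip hjp ▸ hp3)
        · exact hij ((eq_of_colour_eq_inr hci).trans (eq_of_colour_eq_inr (hc ▸ hci)).symm)
  -- The linear forms are chosen once; only the polynomials `f` and `g` depend on the maximal ideal
  -- `M`.
  obtain ⟨y, y', hy⟩ := exists_linearIndependent_extension
    (ι := {x : Fin d × Fin d // x.1 ≠ x.2}) (fun x => ![l x.1.1, l x.1.2])
    fun x => hli x.1.1 x.1.2 x.2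
  have hy' {i j : Fin d} (hij : i ≠ j) : LinearIndependent k ![l i, l j, y, y'] := hy ⟨(i, j), hij⟩
  refine isCohenMacaulayRing_quotient fun M hM _ => ?_
  obtain ⟨f, hf, hfM⟩ := exists_aeval_mem_of_isMaximal hM (linearForm y)
  obtain ⟨g, hg, hgM⟩ := exists_aeval_mem_of_isMaximal hM (linearForm y')
  refine ⟨_, hfM, _, hgM, ?_, fun q hq hIq hfq hgq => ?_⟩
  · rw [hfat]
    apply IsRegularPairMod.colouredIdeal
    · rintro (p | j)
      · rw [colourIdeal]
        split_ifs with hp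
        · have hb : b p ≤ numFactors L p := by
            by_cases h2 : numFactors L p = 2
            · omega
            · exact hb_other p hp.1 h2
          refine Ideal.pow_le_pow_right hb (prod_mem_pow_numFactors L p fun i => ?_)
          rw [Finset.mem_filter, hcol]
          exact ⟨fun h => h.2.2.2, fun h => ⟨Finset.mem_univ i, hp.1, hp.2, h⟩⟩
        · trivial
      · trivial
    · rintro i (p | j) hit
      · rw [colourIdeal]
        split_ifs with hp
        · have hip : L i ∉ p := fun h => hit (hcol.2 ⟨hp.1, hp.2, h⟩)
          obtain ⟨m, n, hmn, rfl⟩ := hmin.1 hp.1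
          exact isRegularMod_lineIdeal_pow (hli m n hmn) hip _
        · exact isRegularMod_top _
      · exact isRegularMod_top _
    · intro i j m hjm hij him
      rw [hspan]
      -- A third factor in this ideal would make the line multiple and force `j` and `m` to share a
      -- colour.
      have hmem : L i ∉ lineIdeal (l j) (l m) := fun h => hsimple hjm
        (three_le_numFactors hij him (hne hjm) h (hleft j m) (hright j m))
      simpa only [pow_one] using isRegularMod_lineIdeal_pow (hli j m (hne hjm)) hmem 1
    · rintro (p | j)
      · rw [colourIdeal]
        split_ifs with hp
        · obtain ⟨m, n, hmn, rfl⟩ := hmin.1 hp.1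
          exact isRegularPairMod_lineIdeal_pow (hy' hmn) hf hg _
        · exact isRegularPairMod_top _ _
      · exact isRegularPairMod_top _ _
    · intro i j hij
      rw [hspan]
      simpa only [pow_one] using isRegularPairMod_lineIdeal_pow (hy' (hne hij)) hf hg 1
  · obtain ⟨p, hp, hpq⟩ := exists_minimalPrime_le_of_fatIdeal_le hq hIq
    obtain ⟨i, j, hij, rfl⟩ := hmin.1 hp
    exact isMaximal_of_lineIdeal_le (hy' hij) hf hg hpq hfq hgq

theorem fatIdeal_eq_top_of_isEmpty {L : Fin 0 → CoordRing k} {b : Ideal (CoordRing k) → ℕ}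
    (hb : ∀ p ∈ (arrangementIdeal L).minimalPrimes, numFactors L p ≠ 2 → b p ≤ numFactors L p) :
    fatIdeal L b = ⊤ := by
  rw [Ideal.eq_top_iff_one, mem_fatIdeal]
  intro p hp
  have h0 : numFactors L p = 0 := by
    rw [numFactors, Set.eq_empty_of_isEmpty {i | L i ∈ p}, Set.ncard_empty]
  have := hb p hp (by omega)
  rw [h0, Nat.le_zero] at this
  rw [this, pow_zero, Ideal.one_eq_top]
  trivial

end Main

end PlaneArrangement


theorem corollary3p5 {k : Type*} [Field k] [CharZero k] {d : ℕ}
    (L : Fin d → PlaneArrangement.CoordRing k) (hL : PlaneArrangement.IsArrangement L)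
    (b : Ideal (PlaneArrangement.CoordRing k) → ℕ)
    (hb_two : ∀ p ∈ (PlaneArrangement.arrangementIdeal L).minimalPrimes,
      PlaneArrangement.numFactors L p = 2 → b p = 1)
    (hb_other : ∀ p ∈ (PlaneArrangement.arrangementIdeal L).minimalPrimes,
      PlaneArrangement.numFactors L p ≠ 2 → b p ≤ PlaneArrangement.numFactors L p)
    (hfactor : ∀ i : Fin d,
      ∀ p ∈ (PlaneArrangement.arrangementIdeal L).minimalPrimes,
      ∀ q ∈ (PlaneArrangement.arrangementIdeal L).minimalPrimes,
        3 ≤ PlaneArrangement.numFactors L p → 3 ≤ PlaneArrangement.numFactors L q →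
        L i ∈ p → L i ∈ q → p = q) :
    IsCohenMacaulayRing
      (PlaneArrangement.CoordRing k ⧸ PlaneArrangement.fatIdeal L b) := by
  -- Euler's formula needs `d ≠ 0`. For the empty arrangement every exponent is at most 0, so the
  -- quotient is the zero ring.
  rcases Nat.eq_zero_or_pos d with rfl | hd
  · refine PlaneArrangement.isCohenMacaulayRing_quotient fun M hM hIM => absurd ?_ hM.ne_top
    rwa [PlaneArrangement.fatIdeal_eq_top_of_isEmpty hb_other, top_le_iff] at hIM
  · choose l hl using fun i => PlaneArrangement.exists_linearForm_eq (hL.isHomogeneous i)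
    refine PlaneArrangement.isCohenMacaulayRing_quotient_fatIdeal (l := l) ?_ ?_ hd.ne'
      (fun i => (hl i).symm) b hb_two hb_other hfactor
    · intro i h0
      exact hL.ne_zero i (by rw [← hl i, h0, map_zero])
    · intro i j hij
      refine LinearIndependent.of_comp PlaneArrangement.linearForm ?_
      convert hL.linearIndependent i j hij using 1
      ext m : 1
      fin_cases m <;> simp [hl]
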